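/- Let $d\ge 1$. There are constants $\tilde C_1,\dots,\tilde C_6>0$ depending only on $d$ such that the following holds. Let $\Gamma\neq 0$ be a symmetric non-negative definite real $d\times d$ matrix with eigenvalues $\lambda_1\ge\dots\ge\lambda_d$ (with multiplicities), let $Y$ be an $\mathbb{R}^d$-valued random vector with the normal distribution $\mathcal N(0,\Gamma^2)$ (mean $0$, covariance matrix $\Gamma^2$), and let $|\cdot|$ be the Euclidean norm. Put, for $t>0$, $$R(t)=\prod_{i=2}^d\left\{\frac{\lambda_1}{(\lambda_1^2-\lambda_i^2)^{1/2}}\wedge\frac{t}{\lambda_1}\right\}\,\frac{\lambda_1}{t}\,\exp\left(-\frac{t^2}{2\lambda_1^2}\right),$$ where $a\wedge b=\min\{a,b\}$, $a/0=\infty$ for $a>0$, and the empty product is $1$. Then for every $t\ge\tilde C_1\lambda_1$: (i) $\mathbb P\{|Y|\ge t\}\le\tilde C_2\,R(t)$; (ii) $\mathbb P\{|Y|\ge t\}\ge\tilde C_3\,R(t)$; (iii) $\mathbb P\{|Y|\ge t-\gamma\lambda_1^2/t\}\le\tilde C_4\,e^{\gamma}\,\mathbb P\{t\le|Y|\le t+\tilde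 C_5\lambda_1^2/t\}$ for all $0\le\gamma<t^2/(4\lambda_1^2)$; (iv) $\mathbb P\{t\le|Y|\le t+\tilde C_5\lambda_1^2/t\}\ge\tilde C_6\,R(t)$. -/

import Mathlib

/-- The eigenvalues `λ₁ ≥ … ≥ λ_d` of a symmetric non-negative definite real `d × d` matrix,
listed in non-increasing order and with multiplicities; the index `i : Fin d` is zero-based. -/
noncomputable def orderedEigenvalues {d : ℕ} {Γ : Matrix (Fin d) (Fin d) ℝ}
    (hΓ : Γ.PosSemidef) (i : Fin d) : ℝ :=
  hΓ.isHermitian.eigenvalues₀ (i.cast (Fintype.card_fin d).symm)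

/-- The minimum `a / (a² - b²)^{1/2} ∧ t / a`, for `0 ≤ b ≤ a` and `0 < a`, with the convention
`a / 0 = ∞`: it equals `t / a` if `b = a`. -/
noncomputable def gapFactor (a b t : ℝ) : ℝ :=
  if b = a then t / a else min (a / Real.sqrt (a ^ 2 - b ^ 2)) (t / a)

/-- The function
`∏_{i=2}^d {λ₁ / (λ₁² - λᵢ²)^{1/2} ∧ t / λ₁} (λ₁ / t) exp (- t² / (2 λ₁²))`
of a sequence `lam` of `d ≥ 1` numbers; the index `0` stands for the first of them, and the
empty product is `1`. -/
noncomputable def gaussianTailRate {d : ℕ} [NeZero d] (lam : Fin d → ℝ) (t : ℝ) : ℝ :=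
  (∏ i ∈ Finset.univ.erase (0 : Fin d), gapFactor (lam 0) (lam i) t) * (lam 0 / t) *
    Real.exp (-(t ^ 2 / (2 * lam 0 ^ 2)))

open MeasureTheory ProbabilityTheory

/-! In an orthonormal eigenbasis, |Y|² is ∑ λᵢ² gᵢ² with independent standard normal gᵢ. Dividing by
λ₁ leaves weights σᵢ ∈ [0, 1] with σ₀ = 1. Fix all coordinates but one and let q be their
contribution. If the remaining weight is 1, reaching level t costs about exp(-(t² - q)/2) / t. The
factor exp(q/2) splits over coordinates and turns each Gaussian density into exp(-(1 - σᵢ²) y²/2),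
whose integral over σᵢ|y| ≤ t has the order of the gap factor. The product of these integrals is the
rate.

For the upper bound (`gaussian_weighted_tail_le`) the event is split by the index j of the dominant
term σⱼ|xⱼ|, and slices are taken along j. A weight σⱼ < 1 costs an extra gapFactor/t
(`gaussianReal_scaled_tail_le`), so every j yields the same rate. For the lower bound
(`gaussian_weighted_annulus_ge`) slices are along coordinate 0, with the others confined to a box on
which q ≤ t²; it already holds for the annulus, so it gives (ii) and (iv). Claim (iii) is (i) at the
shifted level against (iv), since the shift costs at most (4/3)e^γ in the rate. -/

/-! ### The gap factor for largest eigenvalue 1. -/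

theorem gapFactor_one_cases {σ t : ℝ} (h0 : 0 ≤ σ) (h1 : σ ≤ 1) (ht : 1 ≤ t) :
    (gapFactor 1 σ t = t ∧ t ^ 2 * (1 - σ ^ 2) ≤ 1) ∨
      (0 < 1 - σ ^ 2 ∧ gapFactor 1 σ t = 1 / √(1 - σ ^ 2) ∧ gapFactor 1 σ t ≤ t) := by
  unfold gapFactor
  split_ifs with h
  · left; subst h; norm_num
  · have hs : 0 < 1 - σ ^ 2 := by
      have : σ < 1 := lt_of_le_of_ne h1 h
      nlinarith
    have hs' := Real.sqrt_pos.2 hs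
    simp only [one_pow, div_one]
    rcases le_total (1 / √(1 - σ ^ 2)) t with h' | h'
    · right; exact ⟨hs, min_eq_left h', min_le_right _ _⟩
    · left
      rw [min_eq_right h']
      refine ⟨rfl, ?_⟩
      rw [le_div_iff₀ hs'] at h'
      have := pow_le_pow_left₀ (by positivity) h' 2
      rwa [mul_pow, Real.sq_sqrt hs.le, one_pow] at this

theorem gapFactor_one_bounds {σ t : ℝ} (h0 : 0 ≤ σ) (h1 : σ ≤ 1) (ht : 1 ≤ t) :
    1 ≤ gapFactor 1 σ t ∧ gapFactor 1 σ t ≤ t ∧ gapFactor 1 σ t ^ 2 * (1 - σ ^ 2) ≤ 1 := by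
  rcases gapFactor_one_cases h0 h1 ht with ⟨h, h'⟩ | ⟨h, h', h''⟩
  · rw [h]; exact ⟨ht, le_rfl, h'⟩
  · refine ⟨?_, h'', ?_⟩
    · rw [h', le_div_iff₀ (Real.sqrt_pos.2 h), one_mul]
      exact Real.sqrt_le_one.2 (by nlinarith)
    · rw [h', div_pow, Real.sq_sqrt h.le]; field_simp; norm_num

/-! ### One-dimensional Gaussian tails. -/

theorem gaussianPDFReal_standard (x : ℝ) :
    gaussianPDFReal 0 1 x = (√(2 * Real.pi))⁻¹ * Real.exp (-(x ^ 2 / 2)) := by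
  simp [gaussianPDFReal, neg_div]

theorem gaussian_const_le_one : (√(2 * Real.pi))⁻¹ ≤ 1 := by
  refine inv_le_one_of_one_le₀ ?_
  rw [Real.one_le_sqrt]
  linarith [Real.pi_gt_three]

theorem gaussian_const_ge : 1 / 3 ≤ (√(2 * Real.pi))⁻¹ := by
  rw [one_div]
  refine inv_anti₀ (Real.sqrt_pos.2 (by positivity)) ?_
  rw [Real.sqrt_le_left (by norm_num)]
  linarith [Real.pi_lt_four]

theorem gaussianReal_real_apply (s : Set ℝ) :
    (gaussianReal 0 1).real s = ∫ x in s, gaussianPDFReal 0 1 x := by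
  rw [measureReal_def, gaussianReal_apply_eq_integral _ one_ne_zero,
    ENNReal.toReal_ofReal (integral_nonneg fun x => gaussianPDFReal_nonneg _ _ _)]

theorem gaussianReal_Ici_le {u : ℝ} (hu : 0 < u) :
    (gaussianReal 0 1).real (Set.Ici u) ≤ 1 / u * Real.exp (-(u ^ 2 / 2)) := by
  rw [gaussianReal_real_apply, integral_Ici_eq_integral_Ioi]
  calc ∫ x in Set.Ioi u, gaussianPDFReal 0 1 x
      -- The parabola x²/2 lies above its tangent ux - u²/2 at u.
      ≤ ∫ x in Set.Ioi u, Real.exp (u ^ 2 / 2) * Real.exp (-u * x) := by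
        refine setIntegral_mono_on (integrable_gaussianPDFReal 0 1).integrableOn
          ((integrableOn_exp_mul_Ioi (by linarith) u).const_mul _) measurableSet_Ioi ?_
        intro x _
        rw [gaussianPDFReal_standard, ← Real.exp_add]
        calc _ ≤ 1 * Real.exp (-(x ^ 2 / 2)) := by
              gcongr; exact gaussian_const_le_one
          _ ≤ _ := by
              rw [one_mul, Real.exp_le_exp]; nlinarith [sq_nonneg (x - u)]
    _ = 1 / u * Real.exp (-(u ^ 2 / 2)) := by
        rw [integral_const_mul, integral_exp_mul_Ioi (by linarith)]
        rw [neg_div_neg_eq, mul_div_assoc', ← Real.exp_add, div_mul_eq_mul_div, one_mul]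
        congr 2; ring

theorem gaussianReal_abs_ge_le {u : ℝ} (hu : 0 < u) :
    (gaussianReal 0 1).real {x | u ≤ |x|} ≤ 2 / u * Real.exp (-(u ^ 2 / 2)) := by
  have h : {x : ℝ | u ≤ |x|} ⊆ Set.Ici u ∪ (fun x => -x) ⁻¹' Set.Ici u := by
    intro x hx
    rcases le_abs.1 (show u ≤ |x| from hx) with h | h
    · exact Or.inl h
    · exact Or.inr h
  have h2 : (gaussianReal 0 1).real ((fun x => -x) ⁻¹' Set.Ici u)
      = (gaussianReal 0 1).real (Set.Ici u) := by
    rw [← map_measureReal_apply measurable_neg measurableSet_Ici, gaussianReal_map_neg, neg_zero]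
  calc _ ≤ _ := measureReal_mono h
    _ ≤ _ := measureReal_union_le _ _
    _ ≤ _ := by
      rw [h2]
      have := gaussianReal_Ici_le hu
      calc _ ≤ 1 / u * Real.exp (-(u ^ 2 / 2)) + 1 / u * Real.exp (-(u ^ 2 / 2)) :=
            add_le_add this this
        _ = _ := by ring

/-- If the minimum is t, the right side is D ≥ 1. Otherwise gapFactor/t = 1/(st) with s = √(1 - σ²),
and e^v ≥ 1 + v suffices. -/
theorem exp_neg_gap_le {σ t D : ℝ} (h0 : 0 ≤ σ) (h1 : σ ≤ 1) (ht : 1 ≤ t) (hD : 1 ≤ D) :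
    Real.exp (-((1 - σ ^ 2) * t ^ 2 / (2 * D))) ≤ D * (gapFactor 1 σ t / t) := by
  have ht0 : 0 < t := by linarith
  rcases gapFactor_one_cases h0 h1 ht with ⟨h, -⟩ | ⟨h, h', -⟩
  · rw [h, div_self ht0.ne', mul_one]
    refine le_trans (Real.exp_le_one_iff.2 ?_) hD
    have : 0 ≤ 1 - σ ^ 2 := by nlinarith
    have : 0 ≤ (1 - σ ^ 2) * t ^ 2 / (2 * D) := by positivity
    linarith
  · have hs := Real.sqrt_pos.2 h
    set s := √(1 - σ ^ 2) with hs_def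
    have hss : s ^ 2 = 1 - σ ^ 2 := Real.sq_sqrt h.le
    rw [h', ← hss, Real.exp_neg]
    have key : s * t / D ≤ Real.exp (s ^ 2 * t ^ 2 / (2 * D)) := by
      refine le_trans ?_ (Real.add_one_le_exp _)
      rw [div_le_iff₀ (by linarith)]
      have : (s ^ 2 * t ^ 2 / (2 * D) + 1) * D = (s * t) ^ 2 / 2 + D := by
        field_simp
      rw [this]
      nlinarith [sq_nonneg (s * t - 1)]
    calc (Real.exp (s ^ 2 * t ^ 2 / (2 * D)))⁻¹ ≤ (s * t / D)⁻¹ := by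
          refine inv_anti₀ (by positivity) key
      _ = _ := by field_simp

/-- Since 1/σ² ≥ 2 - σ², the exponent (x/σ)² exceeds x² by at least (1 - σ²)x². As x is comparable
to t, this surplus pays for the factor gapFactor/t. -/
theorem gaussianReal_scaled_tail_le {σ t D x : ℝ} (h0 : 0 ≤ σ) (h1 : σ ≤ 1) (ht : 1 ≤ t)
    (hD : 1 ≤ D) (hx : 0 < x) (htx : t ^ 2 ≤ D * x ^ 2) :
    (gaussianReal 0 1).real {y | x ≤ σ * |y|} ≤
      2 * D ^ 2 / t * (gapFactor 1 σ t / t) * Real.exp (-(x ^ 2 / 2)) := by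
  have ht0 : 0 < t := by linarith
  have hg : 0 < gapFactor 1 σ t := by linarith [(gapFactor_one_bounds h0 h1 ht).1]
  rcases h0.eq_or_lt with rfl | hσ
  · have : {y : ℝ | x ≤ 0 * |y|} = ∅ := by
      ext y; simp [hx]
    rw [this, measureReal_empty]
    positivity
  · have hset : {y : ℝ | x ≤ σ * |y|} = {y | x / σ ≤ |y|} := by
      ext y; simp only [Set.mem_ofPred_eq]; rw [div_le_iff₀ hσ, mul_comm]
    rw [hset]
    refine (gaussianReal_abs_ge_le (div_pos hx hσ)).trans ?_
    have e1 : Real.exp (-((x / σ) ^ 2 / 2)) ≤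
        (D * (gapFactor 1 σ t / t)) * Real.exp (-(x ^ 2 / 2)) := by
      refine le_trans ?_ (mul_le_mul_of_nonneg_right (exp_neg_gap_le h0 h1 ht hD)
        (Real.exp_pos _).le)
      rw [← Real.exp_add, Real.exp_le_exp]
      have a1 : (1 - σ ^ 2) * t ^ 2 / (2 * D) ≤ (1 - σ ^ 2) * x ^ 2 / 2 := by
        rw [div_le_div_iff₀ (by positivity) (by norm_num)]
        have : 0 ≤ 1 - σ ^ 2 := by nlinarith
        nlinarith [mul_le_mul_of_nonneg_left htx this]
      have a2 : (2 - σ ^ 2) * x ^ 2 ≤ (x / σ) ^ 2 := by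
        rw [div_pow, le_div_iff₀ (by positivity)]
        nlinarith [mul_nonneg (sq_nonneg (1 - σ ^ 2)) (sq_nonneg x)]
      linarith
    have e2 : 2 / (x / σ) ≤ 2 * D / t := by
      have hxt : t ≤ D * x := by
        refine (sq_le_sq₀ ht0.le (by positivity)).1 ?_
        nlinarith [mul_nonneg (sub_nonneg.2 hD) (mul_nonneg (by linarith : (0:ℝ) ≤ D) (sq_nonneg x))]
      rw [div_div_eq_mul_div, div_le_div_iff₀ hx ht0]
      nlinarith
    calc _ ≤ 2 * D / t * ((D * (gapFactor 1 σ t / t)) * Real.exp (-(x ^ 2 / 2))) := by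
          gcongr
      _ = _ := by ring

/-! ### Truncated exponential moments and the annulus in one dimension. -/

theorem integral_gaussian_truncated_exp (σ : ℝ) (s : Set ℝ) (hs : MeasurableSet s) :
    ∫ y, s.indicator (fun y => Real.exp (σ ^ 2 * y ^ 2 / 2)) y ∂(gaussianReal 0 1) =
      ∫ y in s, (√(2 * Real.pi))⁻¹ * Real.exp (-((1 - σ ^ 2) / 2) * y ^ 2) := by
  rw [integral_gaussianReal_eq_integral_smul one_ne_zero, ← integral_indicator hs]
  congr 1
  ext y
  by_cases hy : y ∈ s
  · simp only [Set.indicator_of_mem hy, gaussianPDFReal_standard, smul_eq_mul]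
    rw [mul_assoc, ← Real.exp_add]
    congr 2; ring
  · simp [Set.indicator_of_notMem hy]

theorem integral_gaussian_truncated_exp_le {σ t : ℝ} (h0 : 0 ≤ σ) (h1 : σ ≤ 1) (ht : 1 ≤ t) :
    ∫ y, {y : ℝ | σ * |y| ≤ t}.indicator (fun y => Real.exp (σ ^ 2 * y ^ 2 / 2)) y
      ∂(gaussianReal 0 1) ≤ 4 * gapFactor 1 σ t := by
  have ht0 : 0 < t := by linarith
  have hms : MeasurableSet {y : ℝ | σ * |y| ≤ t} :=
    measurableSet_le (by fun_prop) (by fun_prop)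
  rw [integral_gaussian_truncated_exp σ _ hms]
  have full (h : 0 < 1 - σ ^ 2) : ∫ y in {y : ℝ | σ * |y| ≤ t},
      (√(2 * Real.pi))⁻¹ * Real.exp (-((1 - σ ^ 2) / 2) * y ^ 2) ≤ 1 / √(1 - σ ^ 2) := by
    refine (setIntegral_le_integral ((integrable_exp_neg_mul_sq (by linarith)).const_mul _)
      (Filter.Eventually.of_forall fun y => by positivity)).trans_eq ?_
    rw [integral_const_mul, integral_gaussian, div_div_eq_mul_div, Real.sqrt_div (by positivity),
      mul_comm Real.pi 2]
    have : √(2 * Real.pi) ≠ 0 := (Real.sqrt_pos.2 (by positivity)).ne'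
    field_simp
  rcases gapFactor_one_cases h0 h1 ht with ⟨h, -⟩ | ⟨h, h', -⟩
  · rw [h]
    -- For σ ≥ 1/2 the domain lies in [-2t, 2t] and the integrand is at most 1. For smaller σ the
    -- domain may be much longer, but the full Gaussian integral is at most 2.
    rcases le_or_gt (1 / 2) σ with hσ | hσ
    · have hsub : {y : ℝ | σ * |y| ≤ t} ⊆ Set.Icc (-(2 * t)) (2 * t) := by
        intro y hy
        simp only [Set.mem_ofPred_eq] at hy
        rw [Set.mem_Icc, ← abs_le]
        nlinarith [abs_nonneg y]
      have hfin : volume {y : ℝ | σ * |y| ≤ t} ≠ ⊤ :=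
        ((measure_mono hsub).trans_lt (by simp)).ne
      have := norm_setIntegral_le_of_norm_le_const (μ := volume)
        (f := fun y => (√(2 * Real.pi))⁻¹ * Real.exp (-((1 - σ ^ 2) / 2) * y ^ 2)) (C := 1)
        (s := {y : ℝ | σ * |y| ≤ t}) hfin.lt_top (fun y _ => by
          rw [Real.norm_of_nonneg (by positivity)]
          refine mul_le_one₀ gaussian_const_le_one (Real.exp_pos _).le (Real.exp_le_one_iff.2 ?_)
          have : 0 ≤ 1 - σ ^ 2 := by nlinarith
          have : 0 ≤ ((1 - σ ^ 2) / 2) * y ^ 2 := by positivity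
          linarith)
      refine (Real.le_norm_self _).trans (this.trans ?_)
      rw [one_mul]
      refine (measureReal_mono hsub (by simp)).trans ?_
      rw [Real.volume_real_Icc_of_le (by linarith)]
      linarith
    · refine (full (by nlinarith)).trans ?_
      have : 1 / 2 ≤ √(1 - σ ^ 2) := Real.le_sqrt_of_sq_le (by nlinarith)
      rw [div_le_iff₀ (by linarith)]
      nlinarith
  · refine (full h).trans ?_
    rw [h']
    have : 0 < 1 / √(1 - σ ^ 2) := by have := Real.sqrt_pos.2 h; positivity
    linarith

/-- With m the gap factor, m²(1 - σ²) ≤ 1 keeps the exponent above -1/2 on the interval. The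
shrinking by D later keeps the sum of several coordinates below t². -/
theorem integral_gaussian_truncated_exp_ge {σ t D : ℝ} (h0 : 0 ≤ σ) (h1 : σ ≤ 1) (ht : 1 ≤ t)
    (hD : 1 ≤ D) :
    1 / (6 * D) * gapFactor 1 σ t ≤
    ∫ y, (Set.Icc (-(gapFactor 1 σ t / D)) (gapFactor 1 σ t / D)).indicator
      (fun y => Real.exp (σ ^ 2 * y ^ 2 / 2)) y ∂(gaussianReal 0 1) := by
  obtain ⟨hm1, hmt, hm⟩ := gapFactor_one_bounds h0 h1 ht
  set m := gapFactor 1 σ t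
  have hmD : 0 < m / D := by positivity
  rw [integral_gaussian_truncated_exp σ _ measurableSet_Icc]
  have hσ2 : 0 ≤ 1 - σ ^ 2 := by nlinarith
  calc 1 / (6 * D) * m ≤ ∫ y in Set.Icc (-(m / D)) (m / D), (1 / 6 : ℝ) := by
        rw [setIntegral_const, Real.volume_real_Icc_of_le (by linarith), smul_eq_mul]
        have : 1 / (6 * D) * m = 1 / 6 * (m / D) := by field_simp
        rw [this]; linarith
    _ ≤ _ := by
        refine setIntegral_mono_on ?_ ?_ measurableSet_Icc ?_
        · exact integrableOn_const (by simp)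
        · exact (by fun_prop : Continuous _).continuousOn.integrableOn_Icc
        · intro y hy
          have hy2 : y ^ 2 ≤ m ^ 2 := by
            refine sq_le_sq' ?_ ?_
            · have : m / D ≤ m := div_le_self (by linarith) hD
              linarith [hy.1]
            · have : m / D ≤ m := div_le_self (by linarith) hD
              linarith [hy.2]
          have : -(1 / 2) ≤ -((1 - σ ^ 2) / 2) * y ^ 2 := by nlinarith
          have h2 : (1 / 2 : ℝ) ≤ Real.exp (-((1 - σ ^ 2) / 2) * y ^ 2) := by
            linarith [Real.add_one_le_exp (-((1 - σ ^ 2) / 2) * y ^ 2)]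
          calc (1 / 6 : ℝ) = 1 / 3 * (1 / 2) := by norm_num
            _ ≤ _ := by
              have := gaussian_const_ge
              gcongr

/-- The set contains an interval [a, b] with b² - a² ≥ 2 and a + b ≤ 4t, hence of length at least
1/(2t). On it x² ≤ t² + 3 - q, whence the factor exp(-3/2). -/
theorem gaussianReal_annulus_ge {q t : ℝ} (hq : 0 ≤ q) (hqt : q ≤ t ^ 2) (ht : 1 ≤ t) :
    1 / 6 * Real.exp (-(3 / 2)) * (1 / t) * Real.exp (-(t ^ 2 / 2)) * Real.exp (q / 2) ≤
      (gaussianReal 0 1).real {x | t ^ 2 ≤ x ^ 2 + q ∧ x ^ 2 + q ≤ (t + 1 / t) ^ 2} := by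
  have ht0 : 0 < t := by linarith
  have htt : (t + 1 / t) ^ 2 = t ^ 2 + 2 + (1 / t) ^ 2 := by field_simp; ring
  have hti : 1 / t ≤ 1 := by rw [div_le_one ht0]; exact ht
  have hti0 : 0 < 1 / t := by positivity
  set a := √(t ^ 2 - q) with ha
  set b := √((t + 1 / t) ^ 2 - q) with hb
  have ha2 : a ^ 2 = t ^ 2 - q := Real.sq_sqrt (by linarith)
  have hb2 : b ^ 2 = (t + 1 / t) ^ 2 - q := Real.sq_sqrt (by nlinarith)
  have ha0 : 0 ≤ a := Real.sqrt_nonneg _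
  have hb0 : 0 ≤ b := Real.sqrt_nonneg _
  have hat : a ≤ t := by nlinarith
  have hbt : b ≤ t + 1 / t := by nlinarith
  have hlen : 1 / (2 * t) ≤ b - a := by
    have h1 : 2 ≤ (b - a) * (b + a) := by nlinarith
    have h2 : b + a ≤ 4 * t := by linarith
    have h3 : 0 ≤ b - a := by nlinarith
    rw [div_le_iff₀ (by positivity)]
    nlinarith
  have hsub : Set.Icc a b ⊆ {x | t ^ 2 ≤ x ^ 2 + q ∧ x ^ 2 + q ≤ (t + 1 / t) ^ 2} := by
    intro x hx
    have := pow_le_pow_left₀ ha0 hx.1 2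
    have := pow_le_pow_left₀ (ha0.trans hx.1) hx.2 2
    constructor <;> linarith
  refine le_trans ?_ (measureReal_mono hsub)
  rw [gaussianReal_real_apply]
  have hab : a ≤ b := by
    have : 0 < 1 / (2 * t) := by positivity
    linarith
  calc _ = 1 / (2 * t) * (1 / 3 * Real.exp (-(3 / 2) + -(t ^ 2 / 2) + q / 2)) := by
        rw [Real.exp_add, Real.exp_add]; field_simp; norm_num
    _ ≤ ∫ x in Set.Icc a b, (1 / 3 * Real.exp (-(3 / 2) + -(t ^ 2 / 2) + q / 2) : ℝ) := by
        rw [setIntegral_const, Real.volume_real_Icc_of_le hab, smul_eq_mul]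
        gcongr
    _ ≤ _ := by
        refine setIntegral_mono_on ?_ (integrable_gaussianPDFReal 0 1).integrableOn
          measurableSet_Icc ?_
        · exact integrableOn_const (by simp)
        · intro x hx
          rw [gaussianPDFReal_standard]
          have := gaussian_const_ge
          have hx2 := pow_le_pow_left₀ (ha0.trans hx.1) hx.2 2
          have : (1 / t) ^ 2 ≤ 1 := pow_le_one₀ hti0.le hti
          gcongr
          linarith

/-! ### Slicing the product Gaussian measure. -/

theorem measureReal_pi_eq_integral_slice {n : ℕ} (μ : Measure ℝ) [IsProbabilityMeasure μ]
    (j : Fin (n + 1)) {E : Set (Fin (n + 1) → ℝ)} (hE : MeasurableSet E) :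
    (Measure.pi fun _ : Fin (n + 1) => μ).real E =
      ∫ y : Fin n → ℝ, μ.real {x | (j.insertNth (α := fun _ => ℝ) x y) ∈ E}
        ∂(Measure.pi fun _ : Fin n => μ) := by
  have mp := (measurePreserving_piFinSuccAbove (fun _ : Fin (n + 1) => μ) j).symm
  rw [← mp.measureReal_preimage hE.nullMeasurableSet, measureReal_def]
  have hm := mp.measurable hE
  rw [Measure.prod_apply_symm hm]
  rw [← integral_toReal (measurable_measure_prodMk_right hm).aemeasurable
    (Filter.Eventually.of_forall fun y => measure_lt_top _ _)]
  rfl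

/-- The exponential weight `exp (σ² y² / 2)` restricted to a set. -/
noncomputable def truncatedExp (σ : ℝ) (s : Set ℝ) (y : ℝ) : ℝ :=
  s.indicator (fun y => Real.exp (σ ^ 2 * y ^ 2 / 2)) y

theorem truncatedExp_nonneg (σ : ℝ) (s : Set ℝ) (y : ℝ) : 0 ≤ truncatedExp σ s y :=
  Set.indicator_nonneg (fun _ _ => (Real.exp_pos _).le) _

theorem integrable_truncatedExp {σ C : ℝ} {s : Set ℝ} (hs : MeasurableSet s)
    (hC : ∀ y ∈ s, σ ^ 2 * y ^ 2 ≤ C) : Integrable (truncatedExp σ s) (gaussianReal 0 1) := by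
  refine Integrable.of_bound (C := Real.exp (C / 2))
    ((Measurable.indicator (by fun_prop) hs).aestronglyMeasurable)
    (Filter.Eventually.of_forall fun y => ?_)
  rw [Real.norm_of_nonneg (truncatedExp_nonneg _ _ _), truncatedExp]
  refine Set.indicator_apply_le' (fun hy => ?_) fun _ => (Real.exp_pos _).le
  have := hC y hy
  gcongr

theorem prod_truncatedExp_of_mem {n : ℕ} {σ y : Fin n → ℝ} {s : Fin n → Set ℝ}
    (h : ∀ i, y i ∈ s i) :
    ∏ i, truncatedExp (σ i) (s i) (y i) = Real.exp ((∑ i, σ i ^ 2 * y i ^ 2) / 2) := by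
  rw [Finset.sum_div, Real.exp_sum]
  exact Finset.prod_congr rfl fun i _ => Set.indicator_of_mem (h i) _

theorem sum_sq_insertNth {n : ℕ} (σ : Fin (n + 1) → ℝ) (j : Fin (n + 1)) (x : ℝ) (y : Fin n → ℝ) :
    ∑ i, σ i ^ 2 * (j.insertNth (α := fun _ => ℝ) x y i) ^ 2 =
      σ j ^ 2 * x ^ 2 + ∑ i, σ (j.succAbove i) ^ 2 * y i ^ 2 := by
  rw [Fin.sum_univ_succAbove _ j]
  simp

/-! ### Two-sided bounds for the weighted sum of squares. -/

theorem gaussian_slice_le {n : ℕ} {σ : Fin (n + 1) → ℝ} (h0 : ∀ i, 0 ≤ σ i) (h1 : ∀ i, σ i ≤ 1)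
    {t : ℝ} (ht : 1 ≤ t) (j : Fin (n + 1)) (y : Fin n → ℝ) :
    (gaussianReal 0 1).real {x | (j.insertNth (α := fun _ => ℝ) x y) ∈
        {x : Fin (n + 1) → ℝ | t ^ 2 ≤ ∑ i, σ i ^ 2 * x i ^ 2 ∧
          ∀ i, σ i * |x i| ≤ σ j * |x j|}} ≤
      2 * (n + 1 : ℝ) ^ 2 / t * (gapFactor 1 (σ j) t / t) * Real.exp (-(t ^ 2 / 2)) *
        (∏ i, truncatedExp (σ (j.succAbove i)) {y | σ (j.succAbove i) * |y| ≤ t} (y i) + 1) := by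
  have ht0 : 0 < t := by linarith
  have hD : (1 : ℝ) ≤ n + 1 := by linarith [(Nat.cast_nonneg n : (0 : ℝ) ≤ n)]
  have hg : 0 < gapFactor 1 (σ j) t := by
    linarith [(gapFactor_one_bounds (h0 j) (h1 j) ht).1]
  have hP : 0 ≤ ∏ i, truncatedExp (σ (j.succAbove i)) {y | σ (j.succAbove i) * |y| ≤ t} (y i) :=
    Finset.prod_nonneg fun i _ => truncatedExp_nonneg _ _ _
  have hmem (x : ℝ) (hx : (j.insertNth (α := fun _ => ℝ) x y) ∈
      {x : Fin (n + 1) → ℝ | t ^ 2 ≤ ∑ i, σ i ^ 2 * x i ^ 2 ∧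
        ∀ i, σ i * |x i| ≤ σ j * |x j|}) :
      t ^ 2 ≤ (σ j * |x|) ^ 2 + ∑ i, σ (j.succAbove i) ^ 2 * y i ^ 2 ∧
      ∀ i, σ (j.succAbove i) * |y i| ≤ σ j * |x| := by
    refine ⟨?_, fun i => ?_⟩
    · have := hx.1
      rwa [sum_sq_insertNth, ← sq_abs x, ← mul_pow] at this
    · simpa using hx.2 (j.succAbove i)
  by_cases hy : ∀ i, σ (j.succAbove i) * |y i| ≤ t
  · rw [prod_truncatedExp_of_mem (s := fun i => {y | σ (j.succAbove i) * |y| ≤ t}) hy]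
    set q := ∑ i, σ (j.succAbove i) ^ 2 * y i ^ 2 with hq
    -- The first entry gives the right exponent. The second, available because the dominant term
    -- carries at least 1/(n + 1) of the sum, keeps the threshold comparable to t even when q is
    -- near or above t².
    have hpos : 0 < max (t ^ 2 - q) (t ^ 2 / (n + 1)) := lt_max_of_lt_right (by positivity)
    set s := √(max (t ^ 2 - q) (t ^ 2 / (n + 1))) with hs
    have hs2 : s ^ 2 = max (t ^ 2 - q) (t ^ 2 / (n + 1)) := Real.sq_sqrt hpos.le
    have hs0 : 0 < s := Real.sqrt_pos.2 hpos
    have hsub : {x | (j.insertNth (α := fun _ => ℝ) x y) ∈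
        {x : Fin (n + 1) → ℝ | t ^ 2 ≤ ∑ i, σ i ^ 2 * x i ^ 2 ∧
          ∀ i, σ i * |x i| ≤ σ j * |x j|}} ⊆ {x | s ≤ σ j * |x|} := by
      intro x hx
      obtain ⟨hx1, hx2⟩ := hmem x hx
      have hσx : 0 ≤ σ j * |x| := mul_nonneg (h0 j) (abs_nonneg x)
      refine Real.sqrt_le_iff.2 ⟨hσx, max_le (by linarith) ?_⟩
      have hqle : q ≤ n * (σ j * |x|) ^ 2 := by
        calc q ≤ ∑ _i : Fin n, (σ j * |x|) ^ 2 := by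
              refine Finset.sum_le_sum fun i _ => ?_
              rw [← sq_abs (y i), ← mul_pow]
              exact pow_le_pow_left₀ (mul_nonneg (h0 _) (abs_nonneg _)) (hx2 i) 2
          _ = _ := by simp
      rw [div_le_iff₀ (by positivity)]
      nlinarith
    refine (measureReal_mono hsub).trans ?_
    refine (gaussianReal_scaled_tail_le (h0 j) (h1 j) ht hD hs0 ?_).trans ?_
    · have : t ^ 2 / (n + 1) ≤ s ^ 2 := hs2 ▸ le_max_right _ _
      rw [div_le_iff₀ (by positivity)] at this
      linarith
    · have h2 : t ^ 2 - q ≤ s ^ 2 := hs2 ▸ le_max_left _ _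
      rw [mul_assoc _ (Real.exp _)]
      have h3 : Real.exp (-(s ^ 2 / 2)) ≤ Real.exp (-(t ^ 2 / 2)) * (Real.exp (q / 2) + 1) := by
        calc _ ≤ Real.exp (-(t ^ 2 / 2) + q / 2) := Real.exp_le_exp.2 (by linarith)
          _ = Real.exp (-(t ^ 2 / 2)) * Real.exp (q / 2) := Real.exp_add _ _
          _ ≤ _ := by gcongr; linarith
      gcongr
  -- Some other term exceeds t, so dominance forces σⱼ|x| ≥ t; the summand 1 covers this case, where
  -- the truncated product vanishes.
  · push Not at hy
    obtain ⟨i, hi⟩ := hy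
    have hsub : {x | (j.insertNth (α := fun _ => ℝ) x y) ∈
        {x : Fin (n + 1) → ℝ | t ^ 2 ≤ ∑ i, σ i ^ 2 * x i ^ 2 ∧
          ∀ i, σ i * |x i| ≤ σ j * |x j|}} ⊆ {x | t ≤ σ j * |x|} := fun x hx =>
      hi.le.trans ((hmem x hx).2 i)
    refine (measureReal_mono hsub).trans ?_
    refine (gaussianReal_scaled_tail_le (h0 j) (h1 j) ht hD ht0 ?_).trans ?_
    · nlinarith [sq_nonneg t]
    · refine le_mul_of_one_le_right (by positivity) (by linarith)

theorem gaussian_dominant_coordinate_tail_le {n : ℕ} {σ : Fin (n + 1) → ℝ} (h0 : ∀ i, 0 ≤ σ i)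
    (h1 : ∀ i, σ i ≤ 1) {t : ℝ} (ht : 1 ≤ t) (j : Fin (n + 1)) :
    (Measure.pi fun _ : Fin (n + 1) => gaussianReal 0 1).real
        {x : Fin (n + 1) → ℝ | t ^ 2 ≤ ∑ i, σ i ^ 2 * x i ^ 2 ∧
          ∀ i, σ i * |x i| ≤ σ j * |x j|} ≤
      2 * (n + 1 : ℝ) ^ 2 * (4 ^ n + 1) *
        ((∏ i, gapFactor 1 (σ i) t) / t * (1 / t) * Real.exp (-(t ^ 2 / 2))) := by
  have ht0 : 0 < t := by linarith
  have hg (i) : 1 ≤ gapFactor 1 (σ i) t := (gapFactor_one_bounds (h0 i) (h1 i) ht).1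
  have hgj := hg j
  have hmeas : MeasurableSet {x : Fin (n + 1) → ℝ | t ^ 2 ≤ ∑ i, σ i ^ 2 * x i ^ 2 ∧
          ∀ i, σ i * |x i| ≤ σ j * |x j|} := by
    refine MeasurableSet.inter (s₁ := {x : Fin (n + 1) → ℝ | t ^ 2 ≤ ∑ i, σ i ^ 2 * x i ^ 2})
      (s₂ := {x : Fin (n + 1) → ℝ | ∀ i, σ i * |x i| ≤ σ j * |x j|})
      (measurableSet_le (by fun_prop) (by fun_prop)) ?_
    simp only [Set.ofPred_forall]
    exact MeasurableSet.iInter fun i => measurableSet_le (by fun_prop) (by fun_prop)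
  have hms (i : Fin n) : MeasurableSet {y : ℝ | σ (j.succAbove i) * |y| ≤ t} :=
    measurableSet_le (by fun_prop) (by fun_prop)
  have hint (i : Fin n) : Integrable
      (truncatedExp (σ (j.succAbove i)) {y | σ (j.succAbove i) * |y| ≤ t})
      (gaussianReal 0 1) := by
    refine integrable_truncatedExp (C := t ^ 2) (hms i) fun y hy => ?_
    rw [← sq_abs y, ← mul_pow]
    exact pow_le_pow_left₀ (mul_nonneg (h0 _) (abs_nonneg _)) hy 2
  have hprod := Integrable.fintype_prod hint
  rw [measureReal_pi_eq_integral_slice _ j hmeas]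
  calc _ ≤ ∫ y : Fin n → ℝ, 2 * (n + 1 : ℝ) ^ 2 / t * (gapFactor 1 (σ j) t / t) *
            Real.exp (-(t ^ 2 / 2)) * (∏ i, truncatedExp (σ (j.succAbove i))
            {y | σ (j.succAbove i) * |y| ≤ t} (y i) + 1)
            ∂(Measure.pi fun _ : Fin n => gaussianReal 0 1) :=
        integral_mono_of_nonneg (Filter.Eventually.of_forall fun y => measureReal_nonneg)
          ((hprod.add (integrable_const 1)).const_mul _)
          (Filter.Eventually.of_forall fun y => gaussian_slice_le h0 h1 ht j y)
    _ = 2 * (n + 1 : ℝ) ^ 2 / t * (gapFactor 1 (σ j) t / t) * Real.exp (-(t ^ 2 / 2)) *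
          (∏ i, ∫ y, truncatedExp (σ (j.succAbove i)) {y | σ (j.succAbove i) * |y| ≤ t} y
            ∂(gaussianReal 0 1) + 1) := by
        rw [integral_const_mul, integral_add hprod (integrable_const 1),
          integral_fintype_prod_eq_prod]
        simp
    _ ≤ 2 * (n + 1 : ℝ) ^ 2 / t * (gapFactor 1 (σ j) t / t) * Real.exp (-(t ^ 2 / 2)) *
          (4 ^ n * ∏ i, gapFactor 1 (σ (j.succAbove i)) t +
            ∏ i, gapFactor 1 (σ (j.succAbove i)) t) := by
        gcongr
        · calc _ ≤ ∏ i : Fin n, 4 * gapFactor 1 (σ (j.succAbove i)) t :=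
                Finset.prod_le_prod
                  (fun i _ => integral_nonneg fun y => truncatedExp_nonneg _ _ _)
                  (fun i _ => integral_gaussian_truncated_exp_le (h0 _) (h1 _) ht)
            _ = _ := by simp [Finset.prod_mul_distrib]
        · exact (Finset.prod_const_one (s := Finset.univ)).symm.trans_le
            (Finset.prod_le_prod (fun _ _ => zero_le_one) fun i _ => hg _)
    _ = _ := by
        -- The gap factor of j completes the product over all indices, so the bound does not depend
        -- on j.
        rw [Fin.prod_univ_succAbove _ j]
        field_simp

/-- The upper bound for the tail of `∑ σᵢ² gᵢ²` with `1 = σ₀ ≥ σᵢ ≥ 0`. -/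
theorem gaussian_weighted_tail_le {n : ℕ} {σ : Fin (n + 1) → ℝ} (h0 : ∀ i, 0 ≤ σ i)
    (h1 : ∀ i, σ i ≤ 1) (hσ : σ 0 = 1) {t : ℝ} (ht : 1 ≤ t) :
    (Measure.pi fun _ : Fin (n + 1) => gaussianReal 0 1).real
        {x : Fin (n + 1) → ℝ | t ^ 2 ≤ ∑ i, σ i ^ 2 * x i ^ 2} ≤
      2 * (n + 1 : ℝ) ^ 3 * (4 ^ n + 1) *
        ((∏ i : Fin n, gapFactor 1 (σ i.succ) t) * (1 / t) * Real.exp (-(t ^ 2 / 2))) := by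
  have ht0 : 0 < t := by linarith
  have hsub : {x : Fin (n + 1) → ℝ | t ^ 2 ≤ ∑ i, σ i ^ 2 * x i ^ 2} ⊆
      ⋃ j, {x : Fin (n + 1) → ℝ | t ^ 2 ≤ ∑ i, σ i ^ 2 * x i ^ 2 ∧
          ∀ i, σ i * |x i| ≤ σ j * |x j|} := by
    intro x hx
    obtain ⟨j, hj⟩ := Finite.exists_max fun i => σ i * |x i|
    exact Set.mem_iUnion.2 ⟨j, hx, hj⟩
  refine (measureReal_mono hsub).trans ((measureReal_iUnion_fintype_le _).trans ?_)
  refine (Finset.sum_le_sum fun j _ =>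
    gaussian_dominant_coordinate_tail_le h0 h1 ht j).trans_eq ?_
  rw [Finset.sum_const, Finset.card_univ, Fintype.card_fin, Fin.prod_univ_succ, hσ]
  -- The gap factor of index 0 cancels one factor 1/t.
  have : gapFactor 1 1 t = t := by simp [gapFactor]
  rw [this, nsmul_eq_mul]
  push_cast
  field_simp

/-- The lower bound for the probability that `√(∑ σᵢ² gᵢ²)` falls into `[t, t + 1 / t]`, with
`1 = σ₀ ≥ σᵢ ≥ 0`. -/
theorem gaussian_weighted_annulus_ge {n : ℕ} {σ : Fin (n + 1) → ℝ} (h0 : ∀ i, 0 ≤ σ i)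
    (h1 : ∀ i, σ i ≤ 1) (hσ : σ 0 = 1) {t : ℝ} (ht : 1 ≤ t) :
    1 / 6 * Real.exp (-(3 / 2)) * (1 / (6 * (n + 1))) ^ n *
        ((∏ i : Fin n, gapFactor 1 (σ i.succ) t) * (1 / t) * Real.exp (-(t ^ 2 / 2))) ≤
      (Measure.pi fun _ : Fin (n + 1) => gaussianReal 0 1).real
        {x : Fin (n + 1) → ℝ | t ^ 2 ≤ ∑ i, σ i ^ 2 * x i ^ 2 ∧
          ∑ i, σ i ^ 2 * x i ^ 2 ≤ (t + 1 / t) ^ 2} := by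
  have ht0 : 0 < t := by linarith
  have hD : (1 : ℝ) ≤ n + 1 := by linarith [(Nat.cast_nonneg n : (0 : ℝ) ≤ n)]
  have hg (i) : 1 ≤ gapFactor 1 (σ i) t := (gapFactor_one_bounds (h0 i) (h1 i) ht).1
  have hmeas : MeasurableSet {x : Fin (n + 1) → ℝ | t ^ 2 ≤ ∑ i, σ i ^ 2 * x i ^ 2 ∧
          ∑ i, σ i ^ 2 * x i ^ 2 ≤ (t + 1 / t) ^ 2} :=
    MeasurableSet.inter (s₁ := {x : Fin (n + 1) → ℝ | t ^ 2 ≤ ∑ i, σ i ^ 2 * x i ^ 2})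
      (s₂ := {x : Fin (n + 1) → ℝ | ∑ i, σ i ^ 2 * x i ^ 2 ≤ (t + 1 / t) ^ 2})
      (measurableSet_le (by fun_prop) (by fun_prop))
      (measurableSet_le (by fun_prop) (by fun_prop))
  set I : Fin n → Set ℝ := fun i => Set.Icc (-(gapFactor 1 (σ i.succ) t / (n + 1)))
    (gapFactor 1 (σ i.succ) t / (n + 1)) with hI
  have hIb (i : Fin n) (y : ℝ) (hy : y ∈ I i) :
      σ i.succ ^ 2 * y ^ 2 ≤ (t / (n + 1)) ^ 2 := by
    have hσ1 : σ i.succ ^ 2 ≤ 1 := pow_le_one₀ (h0 _) (h1 _)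
    have hy2 : y ^ 2 ≤ (gapFactor 1 (σ i.succ) t / (n + 1)) ^ 2 := sq_le_sq' hy.1 hy.2
    have hm : gapFactor 1 (σ i.succ) t / (n + 1) ≤ t / (n + 1) := by
      gcongr; exact (gapFactor_one_bounds (h0 _) (h1 _) ht).2.1
    have hm0 : 0 ≤ gapFactor 1 (σ i.succ) t / (n + 1) := by
      have := hg i.succ; positivity
    calc _ ≤ 1 * y ^ 2 := by gcongr
      _ ≤ _ := by rw [one_mul]; exact hy2.trans (pow_le_pow_left₀ hm0 hm 2)
  rw [measureReal_pi_eq_integral_slice _ 0 hmeas]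
  set c := 1 / 6 * Real.exp (-(3 / 2)) * (1 / t) * Real.exp (-(t ^ 2 / 2)) with hc
  calc _ = c * ∏ i : Fin n, (1 / (6 * ((n : ℝ) + 1)) * gapFactor 1 (σ i.succ) t) := by
        rw [Finset.prod_mul_distrib, Finset.prod_const, Finset.card_univ, Fintype.card_fin, hc]
        ring
    _ ≤ c * ∏ i : Fin n, ∫ y, truncatedExp (σ i.succ) (I i) y ∂(gaussianReal 0 1) := by
        gcongr with i
        · intro i _
          have := hg i.succ
          positivity
        · exact integral_gaussian_truncated_exp_ge (h0 _) (h1 _) ht hD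
    _ = ∫ y : Fin n → ℝ, c * ∏ i, truncatedExp (σ i.succ) (I i) (y i)
          ∂(Measure.pi fun _ : Fin n => gaussianReal 0 1) := by
        rw [integral_const_mul, integral_fintype_prod_eq_prod]
    _ ≤ _ := by
        refine integral_mono_of_nonneg (Filter.Eventually.of_forall fun y => mul_nonneg
          (by positivity) (Finset.prod_nonneg fun i _ => truncatedExp_nonneg _ _ _)) ?_
          (Filter.Eventually.of_forall fun y => ?_)
        · refine Integrable.of_bound (C := 1) ?_ ?_
          · have mp := (measurePreserving_piFinSuccAbove
              (fun _ : Fin (n + 1) => gaussianReal 0 1) 0).symm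
            exact ((measurable_measure_prodMk_right
              (mp.measurable hmeas)).ennreal_toReal).aestronglyMeasurable
          · refine Filter.Eventually.of_forall fun y => ?_
            rw [Real.norm_of_nonneg measureReal_nonneg]
            exact measureReal_le_one
        -- Inside the box q ≤ n t²/(n + 1)² ≤ t², so the one-dimensional annulus bound applies;
        -- outside, the minorant is zero.
        · by_cases hy : ∀ i, y i ∈ I i
          · have hq0 : 0 ≤ ∑ i : Fin n, σ i.succ ^ 2 * y i ^ 2 :=
              Finset.sum_nonneg fun i _ => by positivity
            have hqt : ∑ i : Fin n, σ i.succ ^ 2 * y i ^ 2 ≤ t ^ 2 := by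
              calc _ ≤ ∑ _i : Fin n, (t / (n + 1)) ^ 2 :=
                    Finset.sum_le_sum fun i _ => hIb i _ (hy i)
                _ = n / (n + 1) ^ 2 * t ^ 2 := by
                    simp only [Finset.sum_const, Finset.card_univ, Fintype.card_fin, nsmul_eq_mul]
                    field_simp
                _ ≤ 1 * t ^ 2 := by
                    gcongr
                    rw [div_le_one (by positivity)]
                    nlinarith
                _ = _ := one_mul _
            have := gaussianReal_annulus_ge hq0 hqt ht
            dsimp only
            rw [prod_truncatedExp_of_mem hy]
            refine this.trans_eq ?_
            congr 1
            ext x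
            have e := sum_sq_insertNth σ 0 x y
            simp only [hσ, one_pow, one_mul, Fin.zero_succAbove] at e
            simp only [Set.mem_ofPred_eq, e]
          · push Not at hy
            obtain ⟨i, hi⟩ := hy
            dsimp only
            rw [Finset.prod_eq_zero (Finset.mem_univ i)
              (by simp only [truncatedExp]; exact Set.indicator_of_notMem hi _), mul_zero]
            exact measureReal_nonneg

/-! ### Diagonalization of the covariance. -/

theorem exists_orthonormalBasis_orderedEigenvalues {d : ℕ} {Γ : Matrix (Fin d) (Fin d) ℝ}
    (hΓ : Γ.PosSemidef) : ∃ b : OrthonormalBasis (Fin d) ℝ (EuclideanSpace ℝ (Fin d)),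
      ∀ i, Matrix.toEuclideanCLM (𝕜 := ℝ) Γ (b i) = orderedEigenvalues hΓ i • b i := by
  set e : Fin (Fintype.card (Fin d)) ≃ Fin d := Fintype.equivOfCardEq (Fintype.card_fin _)
  -- `eigenvectorBasis` is labelled through the equivalence `e`; undoing `e` puts it in the order of
  -- `eigenvalues₀`.
  refine ⟨hΓ.isHermitian.eigenvectorBasis.reindex
    (e.symm.trans (finCongr (Fintype.card_fin d))), fun i => ?_⟩
  rw [OrthonormalBasis.reindex_apply]
  set k := (e.symm.trans (finCongr (Fintype.card_fin d))).symm i with hk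
  have h := hΓ.isHermitian.mulVec_eigenvectorBasis k
  have he : hΓ.isHermitian.eigenvalues k = orderedEigenvalues hΓ i := by
    rw [Matrix.IsHermitian.eigenvalues, orderedEigenvalues]
    congr 1
    change e.symm k = _
    simp [hk]
  rw [he] at h
  rw [← WithLp.toLp_ofLp 2 (hΓ.isHermitian.eigenvectorBasis k), Matrix.toEuclideanCLM_toLp, h]
  rfl

theorem norm_sq_apply_sum_eigenbasis {d : ℕ}
    (b : OrthonormalBasis (Fin d) ℝ (EuclideanSpace ℝ (Fin d)))
    (T : EuclideanSpace ℝ (Fin d) →L[ℝ] EuclideanSpace ℝ (Fin d)) (lam : Fin d → ℝ)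
    (h : ∀ i, T (b i) = lam i • b i) (x : Fin d → ℝ) :
    ‖T (∑ i, x i • b i)‖ ^ 2 = ∑ i, lam i ^ 2 * x i ^ 2 := by
  have : T (∑ i, x i • b i) = b.repr.symm (WithLp.toLp 2 fun i => x i * lam i) := by
    rw [map_sum, ← b.sum_repr_symm]
    simp [h, smul_smul]
  rw [this, LinearIsometryEquiv.norm_map, EuclideanSpace.real_norm_sq_eq]
  exact Finset.sum_congr rfl fun i _ => by simp; ring

open scoped MatrixOrder in
-- Y has the law of √(Γ²) = Γ applied to a standard Gaussian vector, whose coordinates are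
-- independent standard normals in any orthonormal basis, in particular an eigenbasis of Γ.
theorem measureReal_norm_sq_multivariateGaussian {d : ℕ} {Γ : Matrix (Fin d) (Fin d) ℝ}
    (hΓ : Γ.PosSemidef) {Ω : Type*} [MeasurableSpace Ω] {P : Measure Ω}
    {Y : Ω → EuclideanSpace ℝ (Fin d)} (hY : HasLaw Y (multivariateGaussian 0 (Γ ^ 2)) P)
    {S : Set ℝ} (hS : MeasurableSet S) :
    P.real {ω | ‖Y ω‖ ^ 2 ∈ S} =
      (Measure.pi fun _ : Fin d => gaussianReal 0 1).real
        {x | ∑ i, orderedEigenvalues hΓ i ^ 2 * x i ^ 2 ∈ S} := by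
  obtain ⟨b, hb⟩ := exists_orthonormalBasis_orderedEigenvalues hΓ
  have hS' : MeasurableSet {y : EuclideanSpace ℝ (Fin d) | ‖y‖ ^ 2 ∈ S} :=
    (by fun_prop : Measurable fun y : EuclideanSpace ℝ (Fin d) => ‖y‖ ^ 2) hS
  have e : P.real {ω | ‖Y ω‖ ^ 2 ∈ S} =
      (multivariateGaussian 0 (Γ ^ 2)).real {y | ‖y‖ ^ 2 ∈ S} := by
    rw [← hY.map_eq, measureReal_def, measureReal_def, Measure.map_apply_of_aemeasurable
      hY.aemeasurable hS']
    rfl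
  rw [e, multivariateGaussian, CFC.sqrt_sq Γ hΓ.nonneg,
    map_measureReal_apply (by fun_prop) hS', stdGaussian_eq_map_pi_orthonormalBasis b,
    map_measureReal_apply (by fun_prop) ((by fun_prop : Measurable _) hS')]
  congr 1
  ext x
  have := norm_sq_apply_sum_eigenbasis b _ _ hb x
  simp only [Set.mem_preimage, Set.mem_ofPred_eq, zero_add, this]

theorem orderedEigenvalues_nonneg {d : ℕ} {Γ : Matrix (Fin d) (Fin d) ℝ}
    (hΓ : Γ.PosSemidef) (i : Fin d) : 0 ≤ orderedEigenvalues hΓ i := by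
  have := hΓ.eigenvalues_nonneg
    ((Fintype.equivOfCardEq (Fintype.card_fin _)) (i.cast (Fintype.card_fin d).symm))
  rwa [Matrix.IsHermitian.eigenvalues, Equiv.symm_apply_apply] at this

theorem orderedEigenvalues_le_zero_index {d : ℕ} [NeZero d] {Γ : Matrix (Fin d) (Fin d) ℝ}
    (hΓ : Γ.PosSemidef) (i : Fin d) : orderedEigenvalues hΓ i ≤ orderedEigenvalues hΓ 0 :=
  hΓ.isHermitian.eigenvalues₀_antitone (by simp)

theorem orderedEigenvalues_zero_pos {d : ℕ} [NeZero d] {Γ : Matrix (Fin d) (Fin d) ℝ}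
    (hΓ : Γ.PosSemidef) (hΓ0 : Γ ≠ 0) : 0 < orderedEigenvalues hΓ 0 := by
  refine (orderedEigenvalues_nonneg hΓ 0).lt_of_ne fun h => hΓ0 ?_
  rw [← hΓ.isHermitian.eigenvalues_eq_zero_iff]
  ext i
  have h1 := orderedEigenvalues_le_zero_index hΓ
    (((Fintype.equivOfCardEq (Fintype.card_fin _)).symm i).cast (Fintype.card_fin d))
  exact le_antisymm (h1.trans_eq h.symm) (hΓ.eigenvalues_nonneg i)

/-! ### Scaling by the largest eigenvalue and shifting the level. -/

theorem gapFactor_normalize {a b t : ℝ} (ha : 0 < a) :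
    gapFactor a b t = gapFactor 1 (b / a) (t / a) := by
  unfold gapFactor
  have h : b / a = 1 ↔ b = a := div_eq_one_iff_eq ha.ne'
  by_cases hb : b = a
  · rw [if_pos hb, if_pos (h.2 hb), div_one]
  · rw [if_neg hb, if_neg (fun h' => hb (h.1 h')), div_one]
    congr 1
    have : a ^ 2 - b ^ 2 = a ^ 2 * (1 ^ 2 - (b / a) ^ 2) := by field_simp
    rw [this, Real.sqrt_mul (sq_nonneg a), Real.sqrt_sq ha.le, div_mul_eq_div_div, div_self ha.ne']

theorem gaussianTailRate_normalize {n : ℕ} {lam : Fin (n + 1) → ℝ} (h : 0 < lam 0) (t : ℝ) :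
    gaussianTailRate lam t = (∏ i : Fin n, gapFactor 1 (lam i.succ / lam 0) (t / lam 0)) *
      (1 / (t / lam 0)) * Real.exp (-((t / lam 0) ^ 2 / 2)) := by
  unfold gaussianTailRate
  have : (Finset.univ : Finset (Fin (n + 1))).erase 0 =
      Finset.univ.map (Fin.succEmb n) := by
    ext i
    simp [Finset.mem_erase, Fin.exists_succ_eq]
  rw [this, Finset.prod_map, one_div_div]
  congr 3
  · exact funext fun i => gapFactor_normalize h
  · field_simp

theorem gapFactor_one_mono {σ s t : ℝ} (h : s ≤ t) : gapFactor 1 σ s ≤ gapFactor 1 σ t := by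
  unfold gapFactor
  split_ifs <;> simp only [div_one]
  · exact h
  · exact min_le_min_left _ h

/-- Gap factors increase with the level, (t - γ/t)² ≥ t² - 2γ gives e^γ, and γ < t²/4 gives t - γ/t
≥ 3t/4, hence the 4/3. The assumption t ≥ 4/3 keeps the shifted level at least 1. -/
theorem normalized_rate_shift_le {n : ℕ} {σ : Fin n → ℝ} (h0 : ∀ i, 0 ≤ σ i)
    (h1 : ∀ i, σ i ≤ 1) {t γ : ℝ} (ht : 4 / 3 ≤ t) (hγ : 0 ≤ γ) (hγt : γ < t ^ 2 / 4) :
    (∏ i, gapFactor 1 (σ i) (t - γ / t)) * (1 / (t - γ / t)) *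
        Real.exp (-((t - γ / t) ^ 2 / 2)) ≤
      4 / 3 * Real.exp γ * ((∏ i, gapFactor 1 (σ i) t) * (1 / t) *
        Real.exp (-(t ^ 2 / 2))) := by
  have ht0 : 0 < t := by linarith
  have hu : γ / t ≤ t / 4 := by
    rw [div_le_div_iff₀ ht0 (by norm_num)]; nlinarith
  have hu0 : 0 ≤ γ / t := by positivity
  have hut : γ / t * t = γ := by field_simp
  have e1 : (1 / (t - γ / t)) ≤ 4 / 3 * (1 / t) := by
    have : 4 / 3 * (1 / t) = 1 / (3 / 4 * t) := by field_simp
    rw [this]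
    exact one_div_le_one_div_of_le (by positivity) (by linarith)
  have e2 : Real.exp (-((t - γ / t) ^ 2 / 2)) ≤ Real.exp γ * Real.exp (-(t ^ 2 / 2)) := by
    rw [← Real.exp_add, Real.exp_le_exp]
    nlinarith [sq_nonneg (γ / t)]
  have g1 (i) : 0 ≤ gapFactor 1 (σ i) (t - γ / t) := by
    linarith [(gapFactor_one_bounds (h0 i) (h1 i) (by linarith : 1 ≤ t - γ / t)).1]
  have e3 : ∏ i, gapFactor 1 (σ i) (t - γ / t) ≤ ∏ i, gapFactor 1 (σ i) t :=
    Finset.prod_le_prod (fun i _ => g1 i) fun i _ => gapFactor_one_mono (by linarith)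
  have p3 : 0 ≤ ∏ i, gapFactor 1 (σ i) (t - γ / t) := Finset.prod_nonneg fun i _ => g1 i
  have p1 : 0 < 1 / (t - γ / t) := by
    have : 0 < t - γ / t := by linarith
    positivity
  calc _ ≤ (∏ i, gapFactor 1 (σ i) t) * (4 / 3 * (1 / t)) *
        (Real.exp γ * Real.exp (-(t ^ 2 / 2))) := by
        have := p3.trans e3
        gcongr
    _ = _ := by ring

/-! ### Assembly of the four estimates. -/

theorem mainTheorem3 (d : ℕ) [NeZero d] :
    ∃ C₁ C₂ C₃ C₄ C₅ C₆ : ℝ,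
      0 < C₁ ∧ 0 < C₂ ∧ 0 < C₃ ∧ 0 < C₄ ∧ 0 < C₅ ∧ 0 < C₆ ∧
      ∀ (Ω : Type*) [MeasurableSpace Ω] (P : MeasureTheory.Measure Ω)
        [MeasureTheory.IsProbabilityMeasure P]
        (Γ : Matrix (Fin d) (Fin d) ℝ) (hΓ : Γ.PosSemidef) (_hΓ0 : Γ ≠ 0)
        (Y : Ω → EuclideanSpace ℝ (Fin d))
        (_hY : ProbabilityTheory.HasLaw Y (ProbabilityTheory.multivariateGaussian 0 (Γ ^ 2)) P)
        (t : ℝ) (_ht : C₁ * orderedEigenvalues hΓ 0 ≤ t),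
        P.real {ω | t ≤ ‖Y ω‖} ≤ C₂ * gaussianTailRate (orderedEigenvalues hΓ) t ∧
        C₃ * gaussianTailRate (orderedEigenvalues hΓ) t ≤ P.real {ω | t ≤ ‖Y ω‖} ∧
        (∀ γ : ℝ, 0 ≤ γ → γ < t ^ 2 / (4 * orderedEigenvalues hΓ 0 ^ 2) →
          P.real {ω | t - γ * orderedEigenvalues hΓ 0 ^ 2 / t ≤ ‖Y ω‖} ≤
            C₄ * Real.exp γ *
              P.real {ω | t ≤ ‖Y ω‖ ∧ ‖Y ω‖ ≤ t + C₅ * orderedEigenvalues hΓ 0 ^ 2 / t}) ∧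
        C₆ * gaussianTailRate (orderedEigenvalues hΓ) t ≤
          P.real {ω | t ≤ ‖Y ω‖ ∧ ‖Y ω‖ ≤ t + C₅ * orderedEigenvalues hΓ 0 ^ 2 / t} := by
  obtain ⟨n, rfl⟩ := Nat.exists_eq_succ_of_ne_zero (NeZero.ne d)
  set A : ℝ := 2 * (n + 1 : ℝ) ^ 3 * (4 ^ n + 1) with hA
  set c : ℝ := 1 / 6 * Real.exp (-(3 / 2)) * (1 / (6 * (n + 1))) ^ n with hc
  have hA0 : 0 < A := by positivity
  have hc0 : 0 < c := by positivity
  -- A and c are the constants of the upper tail and lower annulus bounds. C₁ = 4/3 and the 4/3 in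
  -- C₄ come from the shift of the level; dividing by c trades the rate for the annulus probability.
  refine ⟨4 / 3, A, c, A * (4 / 3) / c, 1, c, by norm_num, hA0, hc0, by positivity, one_pos, hc0,
    ?_⟩
  intro Ω _ P _ Γ hΓ hΓ0 Y hY t ht
  set lam := orderedEigenvalues hΓ with hlam
  have hl : 0 < lam 0 := orderedEigenvalues_zero_pos hΓ hΓ0
  set σ : Fin (n + 1) → ℝ := fun i => lam i / lam 0 with hσ
  have h0 (i) : 0 ≤ σ i := div_nonneg (orderedEigenvalues_nonneg hΓ i) hl.le
  have h1 (i) : σ i ≤ 1 := div_le_one_of_le₀ (orderedEigenvalues_le_zero_index hΓ i) hl.le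
  have hσ0 : σ 0 = 1 := div_self hl.ne'
  set s := t / lam 0 with hs
  have hs43 : 4 / 3 ≤ s := (le_div_iff₀ hl).2 ht
  have hs0 : 0 < s := by linarith
  have hts : t = s * lam 0 := by rw [hs]; field_simp
  have hsum (x : Fin (n + 1) → ℝ) :
      ∑ i, lam i ^ 2 * x i ^ 2 = lam 0 ^ 2 * ∑ i, σ i ^ 2 * x i ^ 2 := by
    rw [Finset.mul_sum]
    refine Finset.sum_congr rfl fun i _ => ?_
    simp only [hσ]; field_simp
  have hrate := gaussianTailRate_normalize hl t
  have tail (u : ℝ) (hu : 0 ≤ u) : P.real {ω | u * lam 0 ≤ ‖Y ω‖} =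
      (Measure.pi fun _ : Fin (n + 1) => gaussianReal 0 1).real
        {x : Fin (n + 1) → ℝ | u ^ 2 ≤ ∑ i, σ i ^ 2 * x i ^ 2} := by
    have := measureReal_norm_sq_multivariateGaussian hΓ hY
      (measurableSet_Ici (a := (u * lam 0) ^ 2))
    convert this using 3
    · refine funext fun ω => propext ?_
      exact (sq_le_sq₀ (by positivity) (norm_nonneg _)).symm
    · refine funext fun x => propext ?_
      rw [← hlam, Set.mem_Ici, hsum, mul_pow, mul_comm, mul_le_mul_iff_right₀ (by positivity)]
  have annulus : P.real {ω | t ≤ ‖Y ω‖ ∧ ‖Y ω‖ ≤ t + 1 * lam 0 ^ 2 / t} =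
      (Measure.pi fun _ : Fin (n + 1) => gaussianReal 0 1).real
        {x : Fin (n + 1) → ℝ | s ^ 2 ≤ ∑ i, σ i ^ 2 * x i ^ 2 ∧
          ∑ i, σ i ^ 2 * x i ^ 2 ≤ (s + 1 / s) ^ 2} := by
    have := measureReal_norm_sq_multivariateGaussian hΓ hY
      (measurableSet_Icc (a := (s * lam 0) ^ 2) (b := ((s + 1 / s) * lam 0) ^ 2))
    have e : t + 1 * lam 0 ^ 2 / t = (s + 1 / s) * lam 0 := by
      rw [hts]; field_simp
    rw [e, hts]
    convert this using 3
    · refine funext fun ω => propext ?_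
      exact and_congr (sq_le_sq₀ (by positivity) (norm_nonneg _)).symm
        (sq_le_sq₀ (norm_nonneg _) (by positivity)).symm
    · refine funext fun x => propext ?_
      rw [← hlam, Set.mem_Icc, hsum, mul_pow, mul_pow, mul_comm, mul_le_mul_iff_right₀ (by positivity),
        mul_comm _ (lam 0 ^ 2), mul_le_mul_iff_right₀ (by positivity)]
  have lower := gaussian_weighted_annulus_ge h0 h1 hσ0 (by linarith : 1 ≤ s)
  rw [← annulus, ← hrate] at lower
  refine ⟨?_, ?_, ?_, lower⟩
  · have := gaussian_weighted_tail_le h0 h1 hσ0 (by linarith : 1 ≤ s)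
    rwa [← tail s hs0.le, ← hts, ← hrate] at this
  · exact lower.trans (measureReal_mono fun ω hω => hω.1)
  · intro γ hγ hγt
    have hγs : γ < s ^ 2 / 4 := by
      rw [hs, div_pow, div_div, mul_comm]; exact hγt
    have hu : γ / s ≤ s / 4 := by
      rw [div_le_div_iff₀ hs0 (by norm_num)]; nlinarith
    have e : t - γ * lam 0 ^ 2 / t = (s - γ / s) * lam 0 := by
      rw [hts]; field_simp
    rw [e, tail _ (by linarith)]
    refine (gaussian_weighted_tail_le h0 h1 hσ0 (by linarith : 1 ≤ s - γ / s)).trans ?_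
    have := normalized_rate_shift_le (fun i => h0 (Fin.succ i)) (fun i => h1 (Fin.succ i))
      hs43 hγ hγs
    rw [← hrate] at this
    calc _ ≤ A * (4 / 3 * Real.exp γ * gaussianTailRate lam t) :=
          mul_le_mul_of_nonneg_left this hA0.le
      _ = A * (4 / 3) / c * Real.exp γ * (c * gaussianTailRate lam t) := by field_simp
      _ ≤ _ := mul_le_mul_of_nonneg_left lower (by positivity)
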